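/- Let $n\ge 1$ and $N=2^n$. Index vectors of size $N$ by $j\in\{0,\dots,N-1\}$ and identify $j$ with the basis state of an $n$-qubit register whose $k$-th qubit is $(j)_k$, the $k$-th binary digit of $j$ (least significant digit first). Let $P_j=\bigotimes_{k=1}^n X^{(j)_k}$, where $X$ is the Pauli matrix, and define $$G_u=\sum_{j=0}^{N-1}P_j\otimes P_j\in\mathbb C^{N^2\times N^2},\qquad V_u=\sum_{j=0}^{N-1}v_jP_j\in\mathbb C^{N\times N}\quad(\vec v\in\mathbb C^N).$$ An elementary gate is an arbitrary unitary acting on one qubit or on two distinct qubits. (1) The first row of $G_u$ is $\mathrm{vec}(I_N)^T$, where $\mathrm{vec}$ stacks the columns of a matrix. There is a circuit of $O(n^2)$ elementary gates on $2n+2$ qubits ($2n$ system qubits and $2$ ancillary qubits) that implements $G_u$ up to the factor $\frac1N$: for every $\psi\in\mathbb C^{N^2}$ it maps $$|0\rangle|0\rangle\otimes\psi\ \longmapsto\ |0\rangle|0\rangle\otimes\tfrac1N G_u\psi+|1\rangle|0\rangle\otimes\left(I-\tfrac1N G_u\right)\psi .$$ (2) For every nonzero $\vec v\in\mathbb C^N$,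 the first row of $V_u$ is $\vec v^T$. With $\lambda_{\max}=\sum_{j=0}^{N-1}|v_j|$, there is a circuit of $O(N)$ elementary gates on $n+1$ qubits ($n$ system qubits and $1$ ancillary qubit) that implements $V_u$ up to the factor $\frac1{\lambda_{\max}}$: for every $\psi\in\mathbb C^N$ there is $\chi\in\mathbb C^N$ such that the circuit maps $$|0\rangle\otimes\psi\ \longmapsto\ |0\rangle\otimes\tfrac{1}{\lambda_{\max}}V_u\psi+|1\rangle\otimes\chi .$$ The constant in $O(n^2)$ is absolute, and the constant in $O(N)$ does not depend on $n$ or $\vec v$. -/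

import Mathlib

open scoped Kronecker

noncomputable section

/-- An elementary gate on a set `Q` of qubits: an arbitrary unitary on one qubit, or an arbitrary
unitary on two distinct qubits. -/
inductive QGate (Q : Type) where
  | one (a : Q) (U : Matrix.unitaryGroup (Fin 2) ℂ) : QGate Q
  | two (a b : Q) (hab : a ≠ b) (U : Matrix.unitaryGroup (Fin 2 × Fin 2) ℂ) : QGate Q

open Classical in
/-- The operator of a gate on the whole qubit set `Q`, in the computational basis `Q → Fin 2`:
the given unitary on the qubits the gate acts on, tensored with the identity on all others. -/
def QGate.toMatrix {Q : Type} : QGate Q → Matrix (Q → Fin 2) (Q → Fin 2) ℂ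
  | .one a U => Matrix.of fun x y =>
      if ∀ c, c ≠ a → x c = y c then U.1 (x a) (y a) else 0
  | .two a b _ U => Matrix.of fun x y =>
      if ∀ c, c ≠ a → c ≠ b → x c = y c then U.1 (x a, x b) (y a, y b) else 0

/-- A circuit is a finite list of elementary gates, the head being applied first.
Its number of gates is the length of the list. -/
abbrev QCircuit (Q : Type) := List (QGate Q)

/-- The operator of a circuit. -/
def QCircuit.toMatrix {Q : Type} [Fintype Q] [DecidableEq Q] :
    QCircuit Q → Matrix (Q → Fin 2) (Q → Fin 2) ℂ
  | [] => 1
  | g :: C => QCircuit.toMatrix C * g.toMatrix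

/-- The state `|z⟩ ⊗ |φ⟩` of `a` ancillary qubits in the basis state `z` and of the qubits `S` in
the state `φ`. -/
def ancillaTensor {a : ℕ} {S : Type} (z : Fin a → Fin 2) (φ : (S → Fin 2) → ℂ) :
    (Fin a ⊕ S → Fin 2) → ℂ :=
  fun x => if (fun i => x (Sum.inl i)) = z then φ (fun s => x (Sum.inr s)) else 0

/-- A vector of size `2 ^ n` as a state of a register of `n` qubits. The index `j` labels the basis
state whose `k`-th qubit is the `k`-th binary digit of `j`, least significant digit first. -/
def oneRegister {n : ℕ} (ψ : Fin (2 ^ n) → ℂ) : (Fin n → Fin 2) → ℂ :=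
  fun b => ψ (finFunctionFinEquiv b)

/-- A vector of size `(2 ^ n) ^ 2`, indexed by pairs, as a state of two registers of `n` qubits. -/
def twoRegisters {n : ℕ} (ψ : Fin (2 ^ n) × Fin (2 ^ n) → ℂ) : (Fin n ⊕ Fin n → Fin 2) → ℂ :=
  fun b => ψ (finFunctionFinEquiv fun k => b (Sum.inl k), finFunctionFinEquiv fun k => b (Sum.inr k))

/-- The `k`-th binary digit of `j`, least significant digit first. -/
def binaryDigit {n : ℕ} (j : Fin (2 ^ n)) (k : Fin n) : Fin 2 := finFunctionFinEquiv.symm j k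

/-- The Pauli matrix `X`. -/
def pauliX : Matrix (Fin 2) (Fin 2) ℂ := !![0, 1; 1, 0]

/-- The Pauli string `P_j`: the tensor product over `k` of `X ^ (j)_k`. -/
def pauliString (n : ℕ) (j : Fin (2 ^ n)) : Matrix (Fin (2 ^ n)) (Fin (2 ^ n)) ℂ :=
  Matrix.of fun x y =>
    ∏ k, (pauliX ^ (binaryDigit j k : ℕ)) (binaryDigit x k) (binaryDigit y k)

/-- `G_u`, the sum over `j` of `P_j ⊗ P_j`. -/
def gatherGate (n : ℕ) :
    Matrix (Fin (2 ^ n) × Fin (2 ^ n)) (Fin (2 ^ n) × Fin (2 ^ n)) ℂ :=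
  ∑ j, pauliString n j ⊗ₖ pauliString n j

/-- `V_u`, the sum over `j` of `v_j P_j`. -/
def multGate (n : ℕ) (v : Fin (2 ^ n) → ℂ) : Matrix (Fin (2 ^ n)) (Fin (2 ^ n)) ℂ :=
  ∑ j, v j • pauliString n j

end

/-! A layer of Hadamard gates diagonalizes all Pauli strings `P_j` at once, turning `P_j` into a
diagonal of signs. Both block encodings therefore reduce to diagonal operators between two Hadamard
layers. For `G_u`, orthogonality of the signs makes the diagonal `2 ^ n` times the projection onto
pairs of equal basis states (`gatherGate_hadamard_conj`). This projection is encoded by flipping an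
ancilla when the registers differ (`exists_circuit_flipOfNe`). The multiply controlled NOT inside
borrows qubits in unknown states and restores them, so linearly many gates suffice. For `V_u`, the
diagonal is the Walsh–Hadamard transform of `v` (`multGate_hadamard_conj`), bounded by `λ_max`.
After scaling, each entry lies in the unit disc and is the corner of a unitary on one ancilla, a
product of two rotations. Rotations selected by all `n` qubits are built by recursion on the
controls (`exists_circuit_muxMatrix`). -/

/-! ### Tensor products of one-qubit operators -/

/-- The tensor product of one-qubit operators. -/
def tensorMatrix {Q : Type} [Fintype Q] (A : Q → Matrix (Fin 2) (Fin 2) ℂ) :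
    Matrix (Q → Fin 2) (Q → Fin 2) ℂ :=
  Matrix.of fun x y => ∏ c, A c (x c) (y c)

theorem tensorMatrix_one {Q : Type} [Fintype Q] [DecidableEq Q] :
    tensorMatrix (1 : Q → Matrix (Fin 2) (Fin 2) ℂ) = 1 := by
  ext x y
  simp only [tensorMatrix, Matrix.of_apply, Pi.one_apply, Matrix.one_apply]
  by_cases h : x = y
  · simp [h]
  · rw [if_neg h]
    obtain ⟨c, hc⟩ := Function.ne_iff.mp h
    exact Finset.prod_eq_zero (Finset.mem_univ c) (if_neg hc)

theorem tensorMatrix_mul {Q : Type} [Fintype Q] [DecidableEq Q]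
    (A B : Q → Matrix (Fin 2) (Fin 2) ℂ) :
    tensorMatrix (A * B) = tensorMatrix A * tensorMatrix B := by
  ext x y
  simp only [tensorMatrix, Matrix.of_apply, Pi.mul_apply, Matrix.mul_apply,
    ← Finset.prod_mul_distrib]
  rw [Finset.prod_univ_sum, Fintype.piFinset_univ]

theorem tensorMatrix_diagonal {Q : Type} [Fintype Q] [DecidableEq Q] (d : Q → Fin 2 → ℂ) :
    tensorMatrix (fun c => Matrix.diagonal (d c)) =
      Matrix.diagonal fun x => ∏ c, d c (x c) := by
  ext x y
  simp only [tensorMatrix, Matrix.of_apply, Matrix.diagonal_apply]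
  by_cases h : x = y
  · simp [h]
  · rw [if_neg h]
    obtain ⟨c, hc⟩ := Function.ne_iff.mp h
    exact Finset.prod_eq_zero (Finset.mem_univ c) (if_neg hc)

theorem tensorMatrix_elim_one_mulVec {a : ℕ} {S : Type} [Fintype S] [DecidableEq S]
    (A : S → Matrix (Fin 2) (Fin 2) ℂ) (z : Fin a → Fin 2) (φ : (S → Fin 2) → ℂ) :
    (tensorMatrix (Sum.elim (1 : Fin a → Matrix (Fin 2) (Fin 2) ℂ) A)).mulVec
        (ancillaTensor z φ) =
      ancillaTensor z ((tensorMatrix A).mulVec φ) := by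
  have h1 : ∀ x y : Fin a → Fin 2,
      (∏ c, (1 : Fin a → Matrix (Fin 2) (Fin 2) ℂ) c (x c) (y c)) = if x = y then 1 else 0 := by
    intro x y
    have := congrFun (congrFun (tensorMatrix_one (Q := Fin a)) x) y
    simpa [tensorMatrix, Matrix.one_apply] using this
  ext x
  simp only [Matrix.mulVec, dotProduct, tensorMatrix, Matrix.of_apply, ancillaTensor]
  rw [← (Equiv.sumArrowEquivProdArrow (Fin a) S (Fin 2)).symm.sum_comp, Fintype.sum_prod_type]
  simp only [Fintype.prod_sum_type, Sum.elim_inl, Sum.elim_inr,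
    Equiv.sumArrowEquivProdArrow_symm_apply_inl, Equiv.sumArrowEquivProdArrow_symm_apply_inr, h1]
  simp only [ite_mul, one_mul, zero_mul]
  rw [Finset.sum_eq_single fun i => x (Sum.inl i)]
  · by_cases h : (fun i => x (Sum.inl i)) = z <;> simp [h]
  · intro y _ hy
    simp [Ne.symm hy]
  · simp

/-! ### Circuit composition and multiplexed gates -/

theorem QCircuit.toMatrix_append {Q : Type} [Fintype Q] [DecidableEq Q] (C D : QCircuit Q) :
    QCircuit.toMatrix (C ++ D) = QCircuit.toMatrix D * QCircuit.toMatrix C := by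
  induction C with
  | nil => simp [QCircuit.toMatrix]
  | cons g C ih => rw [List.cons_append, QCircuit.toMatrix, ih, QCircuit.toMatrix, mul_assoc]

theorem QCircuit.toMatrix_singleton {Q : Type} [Fintype Q] [DecidableEq Q] (g : QGate Q) :
    QCircuit.toMatrix [g] = g.toMatrix := by
  simp [QCircuit.toMatrix]

/-- The one-qubit gate `U x` on qubit `t`, selected by the basis state `x`. -/
def muxMatrix {Q : Type} [Fintype Q] [DecidableEq Q] (t : Q)
    (U : (Q → Fin 2) → Matrix (Fin 2) (Fin 2) ℂ) : Matrix (Q → Fin 2) (Q → Fin 2) ℂ :=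
  Matrix.of fun x y => if ∀ c, c ≠ t → x c = y c then U x (x t) (y t) else 0

theorem muxMatrix_mulVec {Q : Type} [Fintype Q] [DecidableEq Q] (t : Q)
    (U : (Q → Fin 2) → Matrix (Fin 2) (Fin 2) ℂ) (ψ : (Q → Fin 2) → ℂ) (x : Q → Fin 2) :
    (muxMatrix t U).mulVec ψ x = ∑ b, U x (x t) b * ψ (Function.update x t b) := by
  simp only [Matrix.mulVec, dotProduct, muxMatrix, Matrix.of_apply, ite_mul, zero_mul]
  rw [← Finset.sum_filter]
  symm
  apply Finset.sum_bij (fun b _ => Function.update x t b)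
  · intro b _
    simp +contextual
  · intro a _ b _ h
    simpa using congrFun h t
  · intro y hy
    refine ⟨y t, Finset.mem_univ _, ?_⟩
    ext1 c
    by_cases h : c = t
    · subst h; simp
    · simp only [Finset.mem_filter, Finset.mem_univ, true_and] at hy
      simp [h, hy c h]
  · intro b _
    simp

/-- The left factor changes only qubit `t`, so if `V` ignores that qubit, both factors select their
gates by the same data and multiply blockwise. -/
theorem muxMatrix_mul {Q : Type} [Fintype Q] [DecidableEq Q] (t : Q)
    (U V : (Q → Fin 2) → Matrix (Fin 2) (Fin 2) ℂ)
    (hV : ∀ x b, V (Function.update x t b) = V x) :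
    muxMatrix t U * muxMatrix t V = muxMatrix t fun x => U x * V x := by
  apply Matrix.mulVec_injective
  ext ψ x
  rw [← Matrix.mulVec_mulVec]
  simp only [muxMatrix_mulVec, hV, Function.update_self, Function.update_idem, Matrix.mul_apply,
    Finset.sum_mul, Finset.mul_sum]
  rw [Finset.sum_comm]
  simp only [mul_assoc]

theorem QGate.toMatrix_one {Q : Type} [Fintype Q] [DecidableEq Q] (t : Q)
    (U : Matrix.unitaryGroup (Fin 2) ℂ) :
    (QGate.one t U).toMatrix = muxMatrix t fun _ => U.1 := by
  ext x y
  simp only [QGate.toMatrix, muxMatrix, Matrix.of_apply]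
  congr

theorem QGate.toMatrix_one_eq_tensorMatrix {Q : Type} [Fintype Q] [DecidableEq Q] (t : Q)
    (U : Matrix.unitaryGroup (Fin 2) ℂ) :
    (QGate.one t U).toMatrix = tensorMatrix (Pi.mulSingle t U.1) := by
  rw [QGate.toMatrix_one]
  ext x y
  simp only [muxMatrix, tensorMatrix, Matrix.of_apply]
  split_ifs with h
  · rw [Finset.prod_eq_single t]
    · simp
    · intro c _ hc
      simp [Pi.mulSingle_eq_of_ne hc, h c hc]
    · simp
  · push Not at h
    obtain ⟨c, hc, hxy⟩ := h
    refine (Finset.prod_eq_zero (Finset.mem_univ c) ?_).symm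
    rw [Pi.mulSingle_eq_of_ne hc, Matrix.one_apply_ne hxy]

/-- The two-qubit gate that applies `U b` to the target if the control is in the state `b`. -/
def controlledUnitary (U : Fin 2 → Matrix.unitaryGroup (Fin 2) ℂ) :
    Matrix.unitaryGroup (Fin 2 × Fin 2) ℂ :=
  ⟨Matrix.blockDiagonal fun b => (U b).1, by
    rw [Matrix.mem_unitaryGroup_iff, Matrix.star_eq_conjTranspose,
      Matrix.blockDiagonal_conjTranspose, ← Matrix.blockDiagonal_mul, ← Matrix.blockDiagonal_one]
    congr 1
    ext1 b
    exact Matrix.mem_unitaryGroup_iff.mp (U b).2⟩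

theorem QGate.toMatrix_two_controlledUnitary {Q : Type} [Fintype Q] [DecidableEq Q] (t c : Q)
    (h : t ≠ c) (U : Fin 2 → Matrix.unitaryGroup (Fin 2) ℂ) :
    (QGate.two t c h (controlledUnitary U)).toMatrix = muxMatrix t fun x => (U (x c)).1 := by
  ext x y
  simp only [QGate.toMatrix, muxMatrix, Matrix.of_apply, controlledUnitary,
    Matrix.blockDiagonal_apply]
  by_cases hc : x c = y c
  · have : (∀ e, e ≠ t → e ≠ c → x e = y e) ↔ ∀ e, e ≠ t → x e = y e :=
      ⟨fun H e he => if hec : e = c then hec ▸ hc else H e he hec, fun H e he _ => H e he⟩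
    simp [hc, this]
  · have : ¬ ∀ e, e ≠ t → x e = y e := fun H => hc (H c h.symm)
    simp [hc, this]

theorem pauliX_mem : pauliX ∈ Matrix.unitaryGroup (Fin 2) ℂ := by
  rw [Matrix.mem_unitaryGroup_iff]
  ext i j
  fin_cases i <;> fin_cases j <;> simp [pauliX, Matrix.mul_apply]

/-- The one-qubit gate `X ^ b`. -/
def notGate (b : Fin 2) : Matrix.unitaryGroup (Fin 2) ℂ := ⟨pauliX, pauliX_mem⟩ ^ (b : ℕ)

theorem notGate_apply (b i j : Fin 2) : (notGate b).1 i j = if j = i + b then 1 else 0 := by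
  fin_cases b <;> fin_cases i <;> fin_cases j <;> simp [notGate, pauliX]

theorem pauliX_pow_apply (b i j : Fin 2) :
    (pauliX ^ (b : ℕ)) i j = if j = i + b then 1 else 0 := by
  rw [← notGate_apply]; simp [notGate]

/-! ### Multiplexed rotations -/

/-- A multiplexed rotation with `m` controls takes at most `3 * 2 ^ m - 2` elementary gates. -/
theorem exists_circuit_muxMatrix {Q : Type} [Fintype Q] [DecidableEq Q]
    (R : ℝ → Matrix.unitaryGroup (Fin 2) ℂ) (hadd : ∀ a b, R (a + b) = R a * R b)
    (hX : ∀ a, notGate 1 * R a * notGate 1 = R (-a)) (t : Q) (l : List Q) (hl : t ∉ l)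
    (θ : (Q → Fin 2) → ℝ) (hθ : ∀ x y, (∀ c ∈ l, x c = y c) → θ x = θ y) :
    ∃ C : QCircuit Q, C.length + 2 ≤ 3 * 2 ^ l.length ∧
      QCircuit.toMatrix C = muxMatrix t fun x => (R (θ x)).1 := by
  induction l generalizing θ with
  | nil =>
    refine ⟨[.one t (R (θ 0))], by simp, ?_⟩
    rw [QCircuit.toMatrix_singleton, QGate.toMatrix_one]
    congr 1
    ext1 x
    rw [hθ x 0 (by simp)]
  | cons c l ih =>
    simp only [List.mem_cons, not_or] at hl
    have hupd : ∀ x y b, (∀ e ∈ l, x e = y e) →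
        θ (Function.update x c b) = θ (Function.update y c b) := by
      intro x y b h
      apply hθ
      intro e he
      by_cases hec : e = c
      · subst hec; simp
      · simp [hec, h e ((List.mem_cons.mp he).resolve_left hec)]
    -- Half-sum and half-difference of the angles `θ₀`, `θ₁` for the two values of `c`. Conjugation
    -- by `X` negates the second, so `R(half-sum) * X^b * R(half-difference) * X^b = R(θ_b)`.
    obtain ⟨C₁, hC₁, h₁⟩ := ih hl.2
      (fun x => (θ (Function.update x c 0) + θ (Function.update x c 1)) / 2)
      (fun x y h => by simp only [hupd x y _ h])
    obtain ⟨C₂, hC₂, h₂⟩ := ih hl.2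
      (fun x => (θ (Function.update x c 0) - θ (Function.update x c 1)) / 2)
      (fun x y h => by simp only [hupd x y _ h])
    have hcn : QCircuit.toMatrix [QGate.two t c hl.1 (controlledUnitary notGate)] =
        muxMatrix t fun x => (notGate (x c)).1 := by
      rw [QCircuit.toMatrix_singleton, QGate.toMatrix_two_controlledUnitary]
    have hup2 : ∀ x b b', θ (Function.update (Function.update x t b) c b') =
        θ (Function.update x c b') := by
      intro x b b'
      apply hupd
      intro e he
      rw [Function.update_of_ne]
      rintro rfl
      exact hl.2 he
    -- Two recursive circuits and two controlled NOTs: `2 * (3 * 2 ^ m - 2) + 2 = 3 * 2 ^ (m + 1) -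
    -- 2`.
    refine ⟨[QGate.two t c hl.1 (controlledUnitary notGate)] ++ C₂ ++
      [QGate.two t c hl.1 (controlledUnitary notGate)] ++ C₁, ?_, ?_⟩
    · simp only [List.length_append, List.length_cons, List.length_nil, pow_succ]
      omega
    · rw [QCircuit.toMatrix_append, QCircuit.toMatrix_append, QCircuit.toMatrix_append, hcn, h₁, h₂,
        muxMatrix_mul, muxMatrix_mul, muxMatrix_mul]
      · congr 1
        ext1 x
        have hx : θ x = θ (Function.update x c (x c)) := by rw [Function.update_eq_self]
        rw [hx]
        generalize x c = b
        rw [← Submonoid.coe_mul, ← Submonoid.coe_mul, ← Submonoid.coe_mul]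
        congr 1
        fin_cases b
        · simp only [Fin.zero_eta, notGate, pow_zero, one_mul, mul_one]
          rw [← hadd]
          congr 1
          ring
        · simp only [Fin.mk_one]
          rw [← mul_assoc (notGate 1), hX, ← hadd]
          congr 1
          ring
      all_goals
        intro x b
        simp only [hup2, Function.update_of_ne (Ne.symm hl.1)]

/-! ### Rotations and Hadamard gates -/

/-- The real rotation by the angle `a`. -/
noncomputable def rotationY (a : ℝ) : Matrix.unitaryGroup (Fin 2) ℂ :=
  ⟨!![(Real.cos a : ℂ), -(Real.sin a : ℂ); (Real.sin a : ℂ), (Real.cos a : ℂ)], by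
    have h : (Real.cos a : ℂ) * Real.cos a + Real.sin a * Real.sin a = 1 := by
      rw [← pow_two, ← pow_two]; exact_mod_cast Real.cos_sq_add_sin_sq a
    rw [Matrix.mem_unitaryGroup_iff]
    ext i j
    fin_cases i <;> fin_cases j <;>
      simp [Matrix.mul_apply, Matrix.star_apply, -Complex.ofReal_cos, -Complex.ofReal_sin] <;>
      first | linear_combination h | ring⟩

theorem rotationY_add (a b : ℝ) : rotationY (a + b) = rotationY a * rotationY b := by
  ext i j
  fin_cases i <;> fin_cases j <;>
    simp [rotationY, Complex.cos_add, Complex.sin_add] <;> ring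

theorem notGate_conj_rotationY (a : ℝ) : notGate 1 * rotationY a * notGate 1 = rotationY (-a) := by
  ext i j
  fin_cases i <;> fin_cases j <;> simp [rotationY, notGate_apply, Matrix.mul_apply]

/-- The relative phase rotation by the angle `a`. -/
noncomputable def rotationZ (a : ℝ) : Matrix.unitaryGroup (Fin 2) ℂ :=
  ⟨!![Complex.exp (a * Complex.I), 0; 0, Complex.exp (-a * Complex.I)], by
    rw [Matrix.mem_unitaryGroup_iff]
    ext i j
    fin_cases i <;> fin_cases j <;>
      simp [Matrix.mul_apply, Matrix.star_apply, ← Complex.exp_conj, ← Complex.exp_add]⟩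

theorem rotationZ_add (a b : ℝ) : rotationZ (a + b) = rotationZ a * rotationZ b := by
  ext i j
  fin_cases i <;> fin_cases j <;>
    simp [rotationZ, ← Complex.exp_add] <;> ring_nf

theorem notGate_conj_rotationZ (a : ℝ) : notGate 1 * rotationZ a * notGate 1 = rotationZ (-a) := by
  ext i j
  fin_cases i <;> fin_cases j <;> simp [rotationZ, notGate_apply, Matrix.mul_apply]

/-- The Hadamard gate. -/
noncomputable def hadamard : Matrix.unitaryGroup (Fin 2) ℂ :=
  ⟨((Real.sqrt 2 : ℝ) : ℂ)⁻¹ • !![1, 1; 1, -1], by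
    have h : ((Real.sqrt 2 : ℝ) : ℂ)⁻¹ * ((Real.sqrt 2 : ℝ) : ℂ)⁻¹ = 2⁻¹ := by
      rw [← mul_inv]; congr 1; exact_mod_cast Real.mul_self_sqrt zero_le_two
    rw [Matrix.mem_unitaryGroup_iff]
    ext i j
    fin_cases i <;> fin_cases j <;>
      simp [Matrix.mul_apply, Matrix.star_apply] <;> linear_combination 2 * h⟩

theorem hadamard_mul_pauliX_pow_mul_hadamard (b : Fin 2) :
    hadamard.1 * pauliX ^ (b : ℕ) * hadamard.1 =
      Matrix.diagonal fun x : Fin 2 => if x = 1 ∧ b = 1 then (-1 : ℂ) else 1 := by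
  have h : ((Real.sqrt 2 : ℝ) : ℂ)⁻¹ * ((Real.sqrt 2 : ℝ) : ℂ)⁻¹ = 2⁻¹ := by
    rw [← mul_inv]; congr 1; exact_mod_cast Real.mul_self_sqrt zero_le_two
  ext i j
  fin_cases b <;> fin_cases i <;> fin_cases j <;>
    simp [hadamard, pauliX, Matrix.mul_apply] <;> first | linear_combination 2 * h | linear_combination -2 * h

theorem hadamard_mul_hadamard : hadamard.1 * hadamard.1 = 1 := by
  simpa using hadamard_mul_pauliX_pow_mul_hadamard 0

/-- Hadamard gates on all qubits but the ancillary ones. -/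
theorem exists_circuit_hadamard (a : ℕ) (S : Type) [Fintype S] [DecidableEq S] :
    ∃ C : QCircuit (Fin a ⊕ S), C.length = Fintype.card S ∧
      QCircuit.toMatrix C = tensorMatrix (Sum.elim 1 fun _ => hadamard.1) := by
  have key : ∀ l : List S, l.Nodup → ∃ C : QCircuit (Fin a ⊕ S), C.length = l.length ∧
      QCircuit.toMatrix C =
        tensorMatrix (Sum.elim 1 fun s => if s ∈ l then hadamard.1 else 1) := by
    intro l
    induction l with
    | nil =>
      intro _
      refine ⟨[], rfl, ?_⟩
      rw [QCircuit.toMatrix, ← tensorMatrix_one]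
      congr 1
      ext1 c
      cases c <;> simp
    | cons s l ih =>
      intro hl
      rw [List.nodup_cons] at hl
      obtain ⟨C, hC, h⟩ := ih hl.2
      refine ⟨.one (Sum.inr s) hadamard :: C, by simp [hC], ?_⟩
      rw [QCircuit.toMatrix, h, QGate.toMatrix_one_eq_tensorMatrix, ← tensorMatrix_mul]
      congr 1
      ext1 c
      rcases c with c | c
      · simp
      · by_cases hc : c = s
        · subst hc; simp [hl.1]
        · have : (Sum.inr c : Fin a ⊕ S) ≠ Sum.inr s := by simpa using hc
          simp [hc]
  obtain ⟨C, hC, h⟩ := key Finset.univ.toList (Finset.nodup_toList _)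
  exact ⟨C, by simp [hC], by simpa using h⟩

/-! ### Classical reversible circuits -/

/-- The circuit acts on the basis states as the classical reversible map `f`. -/
def QCircuit.Implements {Q : Type} [Fintype Q] [DecidableEq Q] (C : QCircuit Q)
    (f : (Q → Fin 2) → (Q → Fin 2)) : Prop :=
  ∀ ψ x, (QCircuit.toMatrix C).mulVec ψ x = ψ (f x)

/-- States are pulled back: `C` turns `ψ` into `ψ ∘ f`, and `D` then gives `ψ ∘ f ∘ g`. Hence the
map of the later circuit is evaluated first. -/
theorem QCircuit.Implements.append {Q : Type} [Fintype Q] [DecidableEq Q] {C D : QCircuit Q}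
    {f g : (Q → Fin 2) → (Q → Fin 2)} (hC : C.Implements f) (hD : D.Implements g) :
    QCircuit.Implements (C ++ D) (f ∘ g) := by
  intro ψ x
  rw [QCircuit.toMatrix_append, ← Matrix.mulVec_mulVec, hD, hC, Function.comp]

theorem muxMatrix_notGate_mulVec {Q : Type} [Fintype Q] [DecidableEq Q] (t : Q)
    (f : (Q → Fin 2) → Fin 2) (ψ : (Q → Fin 2) → ℂ) (x : Q → Fin 2) :
    (muxMatrix t fun x => (notGate (f x)).1).mulVec ψ x =
      ψ (Function.update x t (x t + f x)) := by
  simp [muxMatrix_mulVec, notGate_apply]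

/-- A fixed one-bit function of the control, added to the target, takes one gate. -/
theorem implements_two {Q : Type} [Fintype Q] [DecidableEq Q] (t c : Q) (h : t ≠ c)
    (f : Fin 2 → Fin 2) :
    QCircuit.Implements [QGate.two t c h (controlledUnitary fun b => notGate (f b))]
      fun x => Function.update x t (x t + f (x c)) := by
  intro ψ x
  rw [QCircuit.toMatrix_singleton, QGate.toMatrix_two_controlledUnitary,
    muxMatrix_notGate_mulVec t fun x => f (x c)]

theorem implements_one {Q : Type} [Fintype Q] [DecidableEq Q] (t : Q) (b : Fin 2) :
    QCircuit.Implements [QGate.one t (notGate b)] fun x => Function.update x t (x t + b) := by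
  intro ψ x
  rw [QCircuit.toMatrix_singleton, QGate.toMatrix_one, muxMatrix_notGate_mulVec t fun _ => b]

/-- A square root of the Pauli matrix `X`. -/
noncomputable def sqrtNot : Matrix.unitaryGroup (Fin 2) ℂ :=
  ⟨(2 : ℂ)⁻¹ • !![1 + Complex.I, 1 - Complex.I; 1 - Complex.I, 1 + Complex.I], by
    rw [Matrix.mem_unitaryGroup_iff]
    ext i j
    fin_cases i <;> fin_cases j <;>
      simp [Matrix.mul_apply, Matrix.star_apply, map_ofNat] <;> ring_nf <;> simp [Complex.I_sq] <;> norm_num⟩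

theorem sqrtNot_mul_sqrtNot : sqrtNot * sqrtNot = notGate 1 := by
  ext i j
  fin_cases i <;> fin_cases j <;>
    simp [sqrtNot, notGate_apply] <;> ring_nf <;> simp [Complex.I_sq] <;> norm_num

/-- The Toffoli gate takes five elementary gates. -/
theorem exists_circuit_toffoli {Q : Type} [Fintype Q] [DecidableEq Q] (t a b : Q) (ha : t ≠ a)
    (hb : t ≠ b) (hab : a ≠ b) :
    ∃ C : QCircuit Q, C.length = 5 ∧
      C.Implements fun x => Function.update x t (x t + x a * x b) := by
  have hcn := implements_two b a hab.symm id
  -- The controlled NOTs write the parity of `a` and `b` into `b` and then undo it, so the middle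
  -- gate is controlled by the parity.
  have hconj : ∀ U : Fin 2 → Matrix.unitaryGroup (Fin 2) ℂ,
      QCircuit.toMatrix ([QGate.two b a hab.symm (controlledUnitary fun b => notGate (id b))] ++
        [QGate.two t b hb (controlledUnitary U)] ++
        [QGate.two b a hab.symm (controlledUnitary fun b => notGate (id b))]) =
      muxMatrix t fun x => (U (x a + x b)).1 := by
    intro U
    apply Matrix.mulVec_injective
    ext ψ x
    rw [QCircuit.toMatrix_append, QCircuit.toMatrix_append, ← Matrix.mulVec_mulVec, hcn,
      ← Matrix.mulVec_mulVec, QCircuit.toMatrix_singleton (.two t b _ _),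
      QGate.toMatrix_two_controlledUnitary,
      muxMatrix_mulVec, muxMatrix_mulVec]
    refine Finset.sum_congr rfl fun i _ => ?_
    rw [hcn]
    simp only [id, Function.update_self, Function.update_of_ne hb, Function.update_of_ne hb.symm,
      Function.update_of_ne ha.symm, Function.update_of_ne hab, add_comm (x a)]
    congr 2
    ext1 c
    by_cases hcb : c = b
    · subst hcb
      simp only [Function.update_self, Function.update_of_ne hb.symm]
      rw [add_assoc, (by generalize x a = i; clear * -; decide +revert : x a + x a = 0), add_zero]
    · by_cases hct : c = t
      · subst hct; simp [hb]
      · simp [hcb, hct]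
  -- Since `a + b - (a xor b) = 2ab`, the three powers of the square root of `X` combine to `X ^
  -- (ab)`.
  refine ⟨[.two t a ha (controlledUnitary fun i => sqrtNot ^ (i : ℕ))] ++
    [.two t b hb (controlledUnitary fun i => sqrtNot ^ (i : ℕ))] ++
    ([QGate.two b a hab.symm (controlledUnitary fun b => notGate (id b))] ++
        [QGate.two t b hb (controlledUnitary fun i => (sqrtNot ^ (i : ℕ))⁻¹)] ++
        [QGate.two b a hab.symm (controlledUnitary fun b => notGate (id b))]), rfl, ?_⟩
  intro ψ x
  refine Eq.trans ?_ (muxMatrix_notGate_mulVec t (fun x => x a * x b) ψ x)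
  rw [QCircuit.toMatrix_append, hconj, QCircuit.toMatrix_append, QCircuit.toMatrix_singleton,
    QCircuit.toMatrix_singleton, QGate.toMatrix_two_controlledUnitary,
    QGate.toMatrix_two_controlledUnitary, muxMatrix_mul, muxMatrix_mul]
  · congr 2
    ext1 y
    rw [← Submonoid.coe_mul, ← Submonoid.coe_mul]
    congr 1
    generalize y a = i
    generalize y b = j
    have h10 : (1 : Fin 2) + 1 = 0 := rfl
    fin_cases i <;> fin_cases j <;> simp [notGate, h10, sqrtNot_mul_sqrtNot]
  · intro y i; simp [ha.symm, hb.symm]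
  · intro y i; simp [ha.symm]

/-- Adding the prefix products of the controls `c` to the qubits `d`. -/
theorem exists_circuit_prefixProducts {Q : Type} [Fintype Q] [DecidableEq Q] (n : ℕ)
    (c : Fin n → Q) (d : Fin (n + 1) → Q) (hd : d.Injective) (hcd : ∀ i j, d i ≠ c j) :
    ∃ (C : QCircuit Q) (f : (Q → Fin 2) → (Q → Fin 2)), C.length = 10 * n + 1 ∧
      C.Implements f ∧
      (∀ x j, f x (d j) = x (d j) + ∏ i with Fin.castSucc i < j, x (c i)) ∧
      ∀ x q, q ∉ Set.range d → f x q = x q := by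
  induction n with
  | zero =>
    -- The empty prefix product is `1`, so a NOT gate suffices.
    refine ⟨_, _, rfl, implements_one (d 0) 1, ?_, ?_⟩
    · intro x j
      obtain rfl : j = 0 := Fin.eq_zero j
      simp
    · intro x q hq
      rw [Function.update_of_ne]
      rintro rfl
      exact hq ⟨0, rfl⟩
  | succ n ih =>
    obtain ⟨C, f, hC, hf, hfd, hfq⟩ := ih (c ∘ Fin.castSucc) (d ∘ Fin.castSucc)
      (hd.comp (Fin.castSucc_injective _)) (fun i j => hcd _ _)
    have hne : ∀ i : Fin (n + 1), d (Fin.castSucc i) ≠ d (Fin.last _) := fun i =>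
      hd.ne (Fin.castSucc_lt_last i).ne
    obtain ⟨T, hT, hg⟩ := exists_circuit_toffoli (d (Fin.last (n + 1))) (c (Fin.last n))
      (d (Fin.castSucc (Fin.last n))) (hcd _ _) (hne _).symm (hcd _ _).symm
    -- `C` adds a prefix product `r` to the control `q` shared by the two Toffoli gates. Modulo 2
    -- they add `p * q + p * (q + r) = p * r`, whatever `q` was.
    refine ⟨T ++ C ++ T, _, ?_, (hg.append hf).append hg, ?_, ?_⟩
    · simp only [List.length_append, hC, hT]; ring
    · have hfc : ∀ x i, f x (c i) = x (c i) := fun x i => hfq x _ (by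
        rintro ⟨j, hj⟩; exact hcd _ _ hj)
      have hfl : ∀ x, f x (d (Fin.last _)) = x (d (Fin.last _)) := fun x => hfq x _ (by
        rintro ⟨j, hj⟩; exact hne j hj)
      intro x j
      simp only [Function.comp]
      induction j using Fin.lastCases with
      | last =>
        have h1 := hfd (Function.update x (d (Fin.last (n + 1)))
          (x (d (Fin.last (n + 1))) + x (c (Fin.last n)) * x (d (Fin.last n).castSucc)))
          (Fin.last n)
        simp only [Function.comp] at h1
        simp only [Function.update_self, hfc, hfl, h1, Function.update_of_ne (hne _),
          Function.update_of_ne (hcd _ _).symm]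
        have h2 : (∏ i with Fin.castSucc i < Fin.last (n + 1), x (c i)) =
            (∏ i with Fin.castSucc i < Fin.last n, x (c (Fin.castSucc i))) * x (c (Fin.last n)) := by
          simp only [Fin.castSucc_lt_last, Finset.filter_true]
          exact Fin.prod_univ_castSucc _
        rw [h2]
        generalize x (c (Fin.last n)) = p
        generalize x (d (Fin.last n).castSucc) = q
        generalize (∏ i with Fin.castSucc i < Fin.last n, x (c (Fin.castSucc i))) = r
        generalize x (d (Fin.last (n + 1))) = s
        clear * -
        decide +revert
      | cast j =>
        have h1 := hfd (Function.update x (d (Fin.last (n + 1)))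
          (x (d (Fin.last (n + 1))) + x (c (Fin.last n)) * x (d (Fin.last n).castSucc))) j
        simp only [Function.comp] at h1
        rw [Function.update_of_ne (hne _), h1, Function.update_of_ne (hne _)]
        congr 1
        simp only [Function.update_of_ne (hcd _ _).symm]
        rw [Finset.prod_filter, Finset.prod_filter, Fin.prod_univ_castSucc]
        simp [Fin.castSucc_lt_castSucc_iff, not_lt.mpr (Fin.le_last j)]
    · intro x q hq
      have h1 : q ≠ d (Fin.last _) := by rintro rfl; exact hq ⟨_, rfl⟩
      have h2 : q ∉ Set.range (d ∘ Fin.castSucc) := by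
        rintro ⟨j, rfl⟩; exact hq ⟨_, rfl⟩
      simp only [Function.comp, Function.update_of_ne h1, hfq _ _ h2]

/-- The multiply controlled NOT with linearly many gates, on a register with as many qubits in
unknown states. -/
theorem exists_circuit_multiControlledNot {Q : Type} [Fintype Q] [DecidableEq Q] (n : ℕ)
    (c : Fin n → Q) (d : Fin (n + 1) → Q) (t : Q) (hd : d.Injective) (hcd : ∀ i j, d i ≠ c j)
    (htc : ∀ i, t ≠ c i) (htd : ∀ i, t ≠ d i) :
    ∃ C : QCircuit Q, C.length = 20 * n + 4 ∧
      C.Implements fun x => Function.update x t (x t + ∏ i, x (c i)) := by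
  obtain ⟨C, f, hC, hf, hfd, hfq⟩ := exists_circuit_prefixProducts n c d hd hcd
  have hT := implements_two t (d (Fin.last n)) (htd _) id
  -- The target receives the last borrowed qubit before and after the full product is added to it,
  -- so the unknown value cancels. Applying `C` twice restores all borrowed qubits.
  refine ⟨_, ?_, fun ψ x => ((((hT.append hf).append hT).append hf) ψ x).trans (congrArg ψ ?_)⟩
  · simp only [List.length_append, List.length_cons, List.length_nil, hC]; ring
  have hfc : ∀ x i, f x (c i) = x (c i) := fun x i => hfq x _ (by
    rintro ⟨j, hj⟩; exact hcd _ _ hj)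
  have hft : ∀ x, f x t = x t := fun x => hfq x _ (by
    rintro ⟨j, hj⟩; exact htd _ hj.symm)
  have hlast : ∀ x, f x (d (Fin.last n)) = x (d (Fin.last n)) + ∏ i, x (c i) := by
    intro x
    rw [hfd]
    simp [Fin.castSucc_lt_last]
  ext1 q
  simp only [Function.comp, id]
  by_cases hqt : q = t
  · subst hqt
    simp only [Function.update_self, hft, hlast, Function.update_of_ne (htd _).symm, hfc,
      Function.update_of_ne (htc _).symm]
    generalize x q = u
    generalize x (d (Fin.last n)) = v
    generalize ∏ i, x (c i) = w
    clear * -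
    decide +revert
  · rw [Function.update_of_ne hqt, Function.update_of_ne hqt]
    by_cases hqd : q ∈ Set.range d
    · obtain ⟨j, rfl⟩ := hqd
      rw [hfd, Function.update_of_ne hqt, hfd]
      simp only [hfc, Function.update_of_ne (htc _).symm]
      generalize x (d j) = u
      generalize (∏ i with Fin.castSucc i < j, x (c i)) = w
      clear * -
      decide +revert
    · rw [hfq _ _ hqd, Function.update_of_ne hqt, hfq _ _ hqd]

/-- Each `b k` is replaced by the bit that tells whether it equals `a k`. -/
theorem exists_circuit_xnor {Q I : Type} [Fintype Q] [DecidableEq Q] (a b : I → Q)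
    (hb : b.Injective) (hab : ∀ i j, b i ≠ a j) (l : List I) (hl : l.Nodup) :
    ∃ (C : QCircuit Q) (f : (Q → Fin 2) → (Q → Fin 2)), C.length = l.length ∧ C.Implements f ∧
      (∀ x, ∀ k ∈ l, f x (b k) = x (b k) + (x (a k) + 1)) ∧
      ∀ x q, (∀ k ∈ l, q ≠ b k) → f x q = x q := by
  induction l with
  | nil =>
    refine ⟨[], id, rfl, ?_, by simp, by simp⟩
    intro ψ x
    simp [QCircuit.toMatrix]
  | cons i l ih =>
    rw [List.nodup_cons] at hl
    obtain ⟨C, f, hC, hf, hfb, hfq⟩ := ih hl.2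
    refine ⟨_, _, ?_, hf.append (implements_two (b i) (a i) (hab _ _) fun s => s + 1), ?_, ?_⟩
    · simp [hC]
    · intro x k hk
      simp only [Function.comp]
      rcases List.mem_cons.mp hk with rfl | hkl
      · rw [hfq, Function.update_self]
        intro j hj hkj
        exact hl.1 (hb hkj ▸ hj)
      · have hki : k ≠ i := by rintro rfl; exact hl.1 hkl
        rw [hfb _ k hkl, Function.update_of_ne (hb.ne hki), Function.update_of_ne (hab _ _).symm]
    · intro x q hq
      simp only [List.mem_cons, forall_eq_or_imp] at hq
      simp only [Function.comp]
      rw [hfq _ _ hq.2, Function.update_of_ne hq.1]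

/-- Flipping a qubit exactly when the two registers are in different basis states. -/
theorem exists_circuit_flipOfNe (n : ℕ) :
    ∃ C : QCircuit (Fin 2 ⊕ (Fin n ⊕ Fin n)), C.length = 22 * n + 5 ∧
      C.Implements fun x => Function.update x (Sum.inl 0) (x (Sum.inl 0) +
        if ∀ k, x (Sum.inr (Sum.inl k)) = x (Sum.inr (Sum.inr k)) then 0 else 1) := by
  obtain ⟨E, f, hE, hf, hfb, hfq⟩ := exists_circuit_xnor
    (fun k : Fin n => (Sum.inr (Sum.inl k) : Fin 2 ⊕ (Fin n ⊕ Fin n)))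
    (fun k => Sum.inr (Sum.inr k)) (fun i j h => by simpa using h) (by simp)
    Finset.univ.toList (Finset.nodup_toList _)
  -- The `n + 1` borrowed qubits are the second ancilla and the first register.
  obtain ⟨T, hT, hg⟩ := exists_circuit_multiControlledNot n
    (fun k : Fin n => (Sum.inr (Sum.inr k) : Fin 2 ⊕ (Fin n ⊕ Fin n)))
    (Fin.cons (Sum.inl 1) fun k => Sum.inr (Sum.inl k)) (Sum.inl 0)
    (Fin.cons_injective_iff.mpr ⟨by simp, fun i j h => by simpa using h⟩)
    (fun i j => by cases i using Fin.cases <;> simp) (by simp)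
    (fun i => by cases i using Fin.cases <;> simp)
  -- The controlled NOT flips on equality, the extra NOT reverses the condition, and repeating `E`
  -- restores the second register.
  refine ⟨_, ?_, fun ψ x => ((((hf.append hg).append
    (implements_one (Sum.inl 0) 1)).append hf) ψ x).trans (congrArg ψ ?_)⟩
  · simp only [List.length_append, List.length_cons, List.length_nil, hE, hT,
      Finset.length_toList, Finset.card_univ, Fintype.card_fin]
    ring
  simp only [Finset.mem_toList, Finset.mem_univ, forall_true_left, ne_eq] at hfb hfq
  have hft : ∀ x i, f x (Sum.inl i) = x (Sum.inl i) := fun x i => hfq x _ (by simp)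
  have hfa : ∀ x k, f x (Sum.inr (Sum.inl k)) = x (Sum.inr (Sum.inl k)) :=
    fun x k => hfq x _ (by simp)
  have hprod : (∏ k, (x (Sum.inr (Sum.inr k)) + (x (Sum.inr (Sum.inl k)) + 1))) =
      if ∀ k, x (Sum.inr (Sum.inl k)) = x (Sum.inr (Sum.inr k)) then 1 else 0 := by
    have h1 : ∀ u v : Fin 2, v + (u + 1) = if u = v then 1 else 0 := by decide
    simp only [h1]
    split_ifs with h
    · simp [h]
    · obtain ⟨k, hk⟩ := not_forall.mp h
      rw [← Finset.mul_prod_erase _ _ (Finset.mem_univ k), if_neg hk, Fin.zero_mul]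
  ext1 q
  simp only [Function.comp]
  rcases q with i | k | k
  · rw [hft]
    by_cases hi : i = 0
    · subst hi
      simp only [Function.update_self, hft]
      simp only [ne_eq, reduceCtorEq, not_false_eq_true, Function.update_of_ne, hfb, hprod]
      split_ifs <;> simp [add_assoc]
    · have hi' : (Sum.inl i : Fin 2 ⊕ (Fin n ⊕ Fin n)) ≠ Sum.inl 0 := by simpa using hi
      simp only [Function.update_of_ne hi', hft]
  · simp [hfa]
  · simp only [hfb, hfa, ne_eq, reduceCtorEq, not_false_eq_true, Function.update_of_ne]
    generalize x (Sum.inr (Sum.inr k)) = u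
    generalize x (Sum.inr (Sum.inl k)) = v
    clear * -
    decide +revert

/-! ### Action on states with ancillas -/

theorem implements_flip_mulVec_ancillaTensor {S : Type} [Fintype S] [DecidableEq S]
    (p : (S → Fin 2) → Prop) [DecidablePred p] (C : QCircuit (Fin 2 ⊕ S))
    (hC : C.Implements fun x => Function.update x (Sum.inl 0) (x (Sum.inl 0) +
      if p fun s => x (Sum.inr s) then 0 else 1)) (φ : (S → Fin 2) → ℂ) :
    (QCircuit.toMatrix C).mulVec (ancillaTensor ![0, 0] φ) =
      ancillaTensor ![0, 0] ((Matrix.diagonal fun x => if p x then 1 else 0).mulVec φ) +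
      ancillaTensor ![1, 0] (φ - (Matrix.diagonal fun x => if p x then 1 else 0).mulVec φ) := by
  ext x
  rw [hC]
  simp only [ancillaTensor, funext_iff, Fin.forall_fin_two, Pi.add_apply, Pi.sub_apply,
    Matrix.mulVec_diagonal]
  have h01 : (Sum.inl 1 : Fin 2 ⊕ S) ≠ Sum.inl 0 := by simp
  simp only [Function.update_self, Function.update_of_ne h01, ne_eq, reduceCtorEq,
    not_false_eq_true, Function.update_of_ne]
  generalize x (Sum.inl 0) = u
  generalize x (Sum.inl 1) = v
  by_cases hp : p fun s => x (Sum.inr s) <;> fin_cases u <;> fin_cases v <;> simp [hp]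

/-- The ancilla starts in `|0⟩`, so only the first column of each selected matrix matters: its top
entry is the encoded diagonal, its bottom entry the remainder. -/
theorem mux_mulVec_ancillaTensor {S : Type} [Fintype S] [DecidableEq S]
    (u : (S → Fin 2) → Matrix (Fin 2) (Fin 2) ℂ) (φ : (S → Fin 2) → ℂ) :
    (muxMatrix (Sum.inl 0 : Fin 1 ⊕ S) fun x => u fun s => x (Sum.inr s)).mulVec
        (ancillaTensor ![0] φ) =
      ancillaTensor ![0] ((Matrix.diagonal fun x => u x 0 0).mulVec φ) +
      ancillaTensor ![1] ((Matrix.diagonal fun x => u x 1 0).mulVec φ) := by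
  ext x
  rw [muxMatrix_mulVec]
  simp only [ancillaTensor, funext_iff, Pi.add_apply, Matrix.mulVec_diagonal,
    Fin.sum_univ_two, Fin.forall_fin_one, ne_eq, reduceCtorEq,
    not_false_eq_true, Function.update_of_ne, Function.update_self]
  generalize x (Sum.inl 0) = v
  fin_cases v <;> simp

/-! ### Hadamard diagonalization of the Pauli sums -/

/-- The sign with which `X ^ b` acts on the `s`-th Hadamard basis state. -/
noncomputable def hadamardSign (s b : Fin 2) : ℂ := if s = 1 ∧ b = 1 then -1 else 1

theorem tensorMatrix_hadamard_mul_self {S : Type} [Fintype S] [DecidableEq S] :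
    tensorMatrix (fun _ : S => hadamard.1) * tensorMatrix (fun _ : S => hadamard.1) = 1 := by
  rw [← tensorMatrix_mul, ← tensorMatrix_one]
  congr 1
  ext1 c
  exact hadamard_mul_hadamard

theorem tensorMatrix_hadamard_conj {S : Type} [Fintype S] [DecidableEq S] (j : S → Fin 2) :
    tensorMatrix (fun _ : S => hadamard.1) * tensorMatrix (fun s => pauliX ^ (j s : ℕ)) *
      tensorMatrix (fun _ : S => hadamard.1) =
      Matrix.diagonal fun x => ∏ s, hadamardSign (x s) (j s) := by
  rw [← tensorMatrix_mul, ← tensorMatrix_mul]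
  refine Eq.trans ?_ (tensorMatrix_diagonal fun s x => hadamardSign x (j s))
  congr 1
  ext1 c
  exact hadamard_mul_pauliX_pow_mul_hadamard (j c)

theorem pauliString_apply {n : ℕ} (j x y : Fin (2 ^ n)) :
    pauliString n j x y =
      tensorMatrix (fun k => pauliX ^ (binaryDigit j k : ℕ)) (binaryDigit x) (binaryDigit y) := rfl

theorem pauliString_zero_apply {n : ℕ} (j y : Fin (2 ^ n)) :
    pauliString n j 0 y = if y = j then 1 else 0 := by
  have h0 : ∀ k, binaryDigit (0 : Fin (2 ^ n)) k = 0 := by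
    intro k
    apply Fin.ext
    simp [binaryDigit, finFunctionFinEquiv]
  simp only [pauliString, Matrix.of_apply, pauliX_pow_apply, h0, zero_add]
  rw [Finset.prod_ite_zero]
  simp only [Finset.mem_univ, forall_true_left, Finset.prod_const_one]
  congr 1
  rw [← funext_iff]
  exact propext finFunctionFinEquiv.symm.injective.eq_iff

/-- Conversion of the state of two registers to a pair of indices. -/
def twoRegistersEquiv (n : ℕ) : (Fin n ⊕ Fin n → Fin 2) ≃ Fin (2 ^ n) × Fin (2 ^ n) :=
  (Equiv.sumArrowEquivProdArrow _ _ _).trans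
    (finFunctionFinEquiv.prodCongr finFunctionFinEquiv)

theorem multGate_submatrix (n : ℕ) (v : Fin (2 ^ n) → ℂ) :
    (multGate n v).submatrix finFunctionFinEquiv finFunctionFinEquiv =
      ∑ j, v j • tensorMatrix fun k => pauliX ^ (binaryDigit j k : ℕ) := by
  ext x y
  have hd : ∀ b : Fin n → Fin 2, binaryDigit (finFunctionFinEquiv b) = b :=
    fun b => finFunctionFinEquiv.symm_apply_apply b
  simp only [multGate, Matrix.submatrix_apply, Matrix.sum_apply, Matrix.smul_apply,
    pauliString_apply, hd]

theorem gatherGate_submatrix (n : ℕ) :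
    (gatherGate n).submatrix (twoRegistersEquiv n) (twoRegistersEquiv n) =
      ∑ j : Fin n → Fin 2, tensorMatrix fun c => pauliX ^ ((Sum.elim j j c : Fin 2) : ℕ) := by
  ext x y
  have hd : ∀ b : Fin n → Fin 2, binaryDigit (finFunctionFinEquiv b) = b :=
    fun b => finFunctionFinEquiv.symm_apply_apply b
  simp only [gatherGate, Matrix.submatrix_apply, Matrix.sum_apply, Matrix.kroneckerMap_apply,
    pauliString_apply]
  rw [← finFunctionFinEquiv.sum_comp]
  simp only [twoRegistersEquiv, Equiv.trans_apply, Equiv.prodCongr_apply, Prod.map, hd,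
    tensorMatrix, Matrix.of_apply, Fintype.prod_sum_type, Sum.elim_inl, Sum.elim_inr]
  rfl

theorem gatherGate_hadamard_conj (n : ℕ) :
    tensorMatrix (fun _ => hadamard.1) *
      (gatherGate n).submatrix (twoRegistersEquiv n) (twoRegistersEquiv n) *
      tensorMatrix (fun _ => hadamard.1) =
    (2 : ℂ) ^ n • Matrix.diagonal fun x : Fin n ⊕ Fin n → Fin 2 =>
      if ∀ k, x (Sum.inl k) = x (Sum.inr k) then (1 : ℂ) else 0 := by
  rw [gatherGate_submatrix, Finset.mul_sum, Finset.sum_mul]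
  simp only [tensorMatrix_hadamard_conj]
  ext x y
  simp only [Matrix.sum_apply, Matrix.smul_apply, Matrix.diagonal_apply]
  by_cases hxy : x = y
  · simp only [if_pos hxy, Fintype.prod_sum_type, Sum.elim_inl, Sum.elim_inr,
      ← Finset.prod_mul_distrib]
    -- The sum over all bit strings factors over the qubits, leaving sign orthogonality on a single
    -- qubit.
    rw [← Fintype.piFinset_univ, ← Finset.prod_univ_sum (fun _ => Finset.univ)
      fun k b => hadamardSign (x (Sum.inl k)) b * hadamardSign (x (Sum.inr k)) b]
    have h1 : ∀ p q : Fin 2, ∑ b, hadamardSign p b * hadamardSign q b = if p = q then 2 else 0 := by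
      intro p q
      fin_cases p <;> fin_cases q <;> (simp [hadamardSign]; try norm_num)
    simp only [h1]
    rw [Finset.prod_ite_zero]
    simp
  · simp [hxy]

theorem multGate_hadamard_conj (n : ℕ) (v : Fin (2 ^ n) → ℂ) :
    tensorMatrix (fun _ => hadamard.1) *
      (multGate n v).submatrix finFunctionFinEquiv finFunctionFinEquiv *
      tensorMatrix (fun _ => hadamard.1) =
    Matrix.diagonal fun x : Fin n → Fin 2 =>
      ∑ j, v j * ∏ k, hadamardSign (x k) (binaryDigit j k) := by
  rw [multGate_submatrix, Finset.mul_sum, Finset.sum_mul]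
  simp only [Matrix.mul_smul, Matrix.smul_mul, tensorMatrix_hadamard_conj]
  ext x y
  simp only [Matrix.sum_apply, Matrix.smul_apply, Matrix.diagonal_apply]
  by_cases hxy : x = y <;> simp [hxy]

theorem gatherGate_row_zero (n : ℕ) :
    (gatherGate n).row (0, 0) = Matrix.vec (1 : Matrix (Fin (2 ^ n)) (Fin (2 ^ n)) ℂ) := by
  ext ⟨a, b⟩
  simp only [gatherGate, Matrix.row, Matrix.sum_apply, Matrix.kroneckerMap_apply,
    pauliString_zero_apply, Matrix.vec, Matrix.one_apply]
  simp [eq_comm]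

theorem multGate_row_zero (n : ℕ) (v : Fin (2 ^ n) → ℂ) : (multGate n v).row 0 = v := by
  ext a
  simp only [multGate, Matrix.row, Matrix.sum_apply, Matrix.smul_apply, pauliString_zero_apply]
  simp

/-! ### The two block encodings -/

theorem exists_circuit_gatherGate (n : ℕ) :
    ∃ C : QCircuit (Fin 2 ⊕ (Fin n ⊕ Fin n)), C.length = 26 * n + 5 ∧
      ∀ ψ : Fin (2 ^ n) × Fin (2 ^ n) → ℂ,
        (QCircuit.toMatrix C).mulVec (ancillaTensor ![0, 0] (twoRegisters ψ)) =
          ancillaTensor ![0, 0] (twoRegisters (((2 : ℂ) ^ n)⁻¹ • (gatherGate n).mulVec ψ)) +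
            ancillaTensor ![1, 0]
              (twoRegisters (ψ - ((2 : ℂ) ^ n)⁻¹ • (gatherGate n).mulVec ψ)) := by
  obtain ⟨H, hH, hHm⟩ := exists_circuit_hadamard 2 (Fin n ⊕ Fin n)
  obtain ⟨P, hP, hPi⟩ := exists_circuit_flipOfNe n
  refine ⟨H ++ P ++ H, ?_, fun ψ => ?_⟩
  · simp only [List.length_append, hH, hP, Fintype.card_sum, Fintype.card_fin]
    ring
  have hψ : ∀ ψ : Fin (2 ^ n) × Fin (2 ^ n) → ℂ, twoRegisters ψ = ψ ∘ twoRegistersEquiv n :=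
    fun _ => rfl
  have hD : tensorMatrix (fun _ => hadamard.1) *
      (Matrix.diagonal fun x : Fin n ⊕ Fin n → Fin 2 =>
        if ∀ k, x (Sum.inl k) = x (Sum.inr k) then (1 : ℂ) else 0) *
      tensorMatrix (fun _ => hadamard.1) =
      ((2 : ℂ) ^ n)⁻¹ •
        (gatherGate n).submatrix (twoRegistersEquiv n) (twoRegistersEquiv n) := by
    have h := gatherGate_hadamard_conj n
    rw [← inv_smul_eq_iff₀ (pow_ne_zero n two_ne_zero)] at h
    rw [← h, Matrix.mul_smul, Matrix.smul_mul, ← mul_assoc, ← mul_assoc,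
      tensorMatrix_hadamard_mul_self, one_mul, mul_assoc, tensorMatrix_hadamard_mul_self, mul_one]
  have hG : (((2 : ℂ) ^ n)⁻¹ • (gatherGate n).mulVec ψ) ∘ twoRegistersEquiv n =
      (tensorMatrix (fun _ => hadamard.1)).mulVec
      ((Matrix.diagonal fun x : Fin n ⊕ Fin n → Fin 2 =>
        if ∀ k, x (Sum.inl k) = x (Sum.inr k) then (1 : ℂ) else 0).mulVec
      ((tensorMatrix (fun _ => hadamard.1)).mulVec (ψ ∘ twoRegistersEquiv n))) := by
    rw [Matrix.mulVec_mulVec, Matrix.mulVec_mulVec, hD, Matrix.smul_mulVec,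
      Matrix.submatrix_mulVec_equiv]
    simp [Function.comp_assoc, Pi.smul_comp]
  rw [QCircuit.toMatrix_append, QCircuit.toMatrix_append, ← Matrix.mulVec_mulVec,
    ← Matrix.mulVec_mulVec, hHm, tensorMatrix_elim_one_mulVec,
    implements_flip_mulVec_ancillaTensor
      (fun x : Fin n ⊕ Fin n → Fin 2 => ∀ k, x (Sum.inl k) = x (Sum.inr k)) P hPi,
    Matrix.mulVec_add, tensorMatrix_elim_one_mulVec, tensorMatrix_elim_one_mulVec,
    Matrix.mulVec_sub]
  simp only [hψ, Pi.sub_comp]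
  have hH2 : (tensorMatrix fun _ => hadamard.1).mulVec ((tensorMatrix fun _ => hadamard.1).mulVec
      (ψ ∘ twoRegistersEquiv n)) = ψ ∘ twoRegistersEquiv n := by
    rw [Matrix.mulVec_mulVec, tensorMatrix_hadamard_mul_self, Matrix.one_mulVec]
  rw [hG, hH2]

/-- Polar form: the real rotation supplies the modulus as a cosine, the phase rotation the argument.
-/
theorem rotationZ_mul_rotationY_apply_zero (a : ℂ) (ha : ‖a‖ ≤ 1) :
    ((rotationZ a.arg).1 * (rotationY (Real.arccos ‖a‖)).1) 0 0 = a := by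
  have h : Real.cos (Real.arccos ‖a‖) = ‖a‖ :=
    Real.cos_arccos (by linarith [norm_nonneg a]) ha
  simp only [rotationZ, rotationY, Matrix.mul_apply, Fin.sum_univ_two, Matrix.of_apply,
    Matrix.cons_val', Matrix.cons_val_zero, Matrix.cons_val_one, Matrix.cons_val_fin_one,
    zero_mul, add_zero, h]
  rw [mul_comm]
  exact Complex.norm_mul_exp_arg_mul_I a

theorem exists_circuit_multGate (n : ℕ) (v : Fin (2 ^ n) → ℂ) :
    ∃ C : QCircuit (Fin 1 ⊕ Fin n), C.length ≤ 8 * 2 ^ n ∧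
      ∀ ψ : Fin (2 ^ n) → ℂ, ∃ χ : Fin (2 ^ n) → ℂ,
        (QCircuit.toMatrix C).mulVec (ancillaTensor ![0] (oneRegister ψ)) =
          ancillaTensor ![0]
            (oneRegister (((∑ j, ‖v j‖ : ℝ) : ℂ)⁻¹ • (multGate n v).mulVec ψ)) +
          ancillaTensor ![1] (oneRegister χ) := by
  set μ : (Fin n → Fin 2) → ℂ := fun x => ((∑ j, ‖v j‖ : ℝ) : ℂ)⁻¹ *
    ∑ j, v j * ∏ k, hadamardSign (x k) (binaryDigit j k) with hμ
  have hμ1 : ∀ x, ‖μ x‖ ≤ 1 := by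
    intro x
    have h0 : 0 ≤ ∑ j, ‖v j‖ := Finset.sum_nonneg fun _ _ => norm_nonneg _
    have hs : ∀ s b, ‖hadamardSign s b‖ = 1 := by
      intro s b
      unfold hadamardSign
      split_ifs <;> simp
    rw [hμ, norm_mul, norm_inv, Complex.norm_of_nonneg h0]
    refine (mul_le_mul_of_nonneg_left (norm_sum_le _ _) (inv_nonneg.mpr h0)).trans ?_
    simp only [norm_mul, norm_prod, hs, Finset.prod_const_one, mul_one]
    -- This covers a vanishing sum too, where the inverse is `0` by convention.
    exact inv_mul_le_one
  obtain ⟨H, hH, hHm⟩ := exists_circuit_hadamard 1 (Fin n)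
  have hrot : ∀ (R : ℝ → Matrix.unitaryGroup (Fin 2) ℂ), (∀ a b, R (a + b) = R a * R b) →
      (∀ a, notGate 1 * R a * notGate 1 = R (-a)) → ∀ θ : (Fin n → Fin 2) → ℝ,
      ∃ C : QCircuit (Fin 1 ⊕ Fin n), C.length + 2 ≤ 3 * 2 ^ n ∧
        QCircuit.toMatrix C =
          muxMatrix (Sum.inl 0) fun x => (R (θ fun s => x (Sum.inr s))).1 := by
    intro R h1 h2 θ
    obtain ⟨C, hC, h⟩ := exists_circuit_muxMatrix R h1 h2 (Sum.inl 0 : Fin 1 ⊕ Fin n)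
      ((List.finRange n).map Sum.inr) (by simp) (fun x => θ fun s => x (Sum.inr s))
      (fun x y hxy => by
        congr 1
        ext1 s
        exact hxy _ (by simp))
    exact ⟨C, by simpa using hC, h⟩
  obtain ⟨Y, hY, hYm⟩ := hrot rotationY rotationY_add notGate_conj_rotationY
    fun x => Real.arccos ‖μ x‖
  obtain ⟨Z, hZ, hZm⟩ := hrot rotationZ rotationZ_add notGate_conj_rotationZ
    fun x => (μ x).arg
  refine ⟨H ++ (Y ++ Z) ++ H, ?_, fun ψ => ?_⟩
  -- `2 * n` Hadamards and two rotations of at most `3 * 2 ^ n - 2` gates, with `n ≤ 2 ^ n`.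
  · simp only [List.length_append, hH, Fintype.card_fin]
    have := (Nat.lt_two_pow_self (n := n)).le
    omega
  have hψ : ∀ ψ : Fin (2 ^ n) → ℂ, oneRegister ψ = ψ ∘ finFunctionFinEquiv := fun _ => rfl
  have hD : tensorMatrix (fun _ => hadamard.1) * Matrix.diagonal μ *
      tensorMatrix (fun _ => hadamard.1) = ((∑ j, ‖v j‖ : ℝ) : ℂ)⁻¹ •
        (multGate n v).submatrix finFunctionFinEquiv finFunctionFinEquiv := by
    have h : Matrix.diagonal μ = ((∑ j, ‖v j‖ : ℝ) : ℂ)⁻¹ • Matrix.diagonal fun x : Fin n → Fin 2 =>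
      ∑ j, v j * ∏ k, hadamardSign (x k) (binaryDigit j k) := by
      rw [← Matrix.diagonal_smul]; rfl
    rw [h, ← multGate_hadamard_conj, Matrix.mul_smul, Matrix.smul_mul, ← mul_assoc, ← mul_assoc,
      tensorMatrix_hadamard_mul_self, one_mul, mul_assoc, tensorMatrix_hadamard_mul_self, mul_one]
  have hV : (((∑ j, ‖v j‖ : ℝ) : ℂ)⁻¹ • (multGate n v).mulVec ψ) ∘ finFunctionFinEquiv =
      (tensorMatrix (fun _ => hadamard.1)).mulVec ((Matrix.diagonal μ).mulVec
      ((tensorMatrix (fun _ => hadamard.1)).mulVec (ψ ∘ finFunctionFinEquiv))) := by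
    rw [Matrix.mulVec_mulVec, Matrix.mulVec_mulVec, hD, Matrix.smul_mulVec,
      Matrix.submatrix_mulVec_equiv]
    simp [Function.comp_assoc, Pi.smul_comp]
  have hYZ : QCircuit.toMatrix (Y ++ Z) = muxMatrix (Sum.inl 0) fun x =>
      (fun s => (rotationZ (μ s).arg).1 * (rotationY (Real.arccos ‖μ s‖)).1)
        fun s => x (Sum.inr s) := by
    rw [QCircuit.toMatrix_append, hYm, hZm, muxMatrix_mul]
    simp
  refine ⟨(tensorMatrix (fun _ => hadamard.1)).mulVec ((Matrix.diagonal fun x =>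
    ((rotationZ (μ x).arg).1 * (rotationY (Real.arccos ‖μ x‖)).1) 1 0).mulVec
      ((tensorMatrix (fun _ => hadamard.1)).mulVec (ψ ∘ finFunctionFinEquiv))) ∘
        finFunctionFinEquiv.symm, ?_⟩
  rw [QCircuit.toMatrix_append, QCircuit.toMatrix_append, ← Matrix.mulVec_mulVec,
    ← Matrix.mulVec_mulVec, hHm, hYZ, tensorMatrix_elim_one_mulVec, mux_mulVec_ancillaTensor
      fun s => (rotationZ (μ s).arg).1 * (rotationY (Real.arccos ‖μ s‖)).1,
    Matrix.mulVec_add, tensorMatrix_elim_one_mulVec, tensorMatrix_elim_one_mulVec]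
  simp only [rotationZ_mul_rotationY_apply_zero _ (hμ1 _)]
  simp only [hψ, Function.comp_assoc, Equiv.symm_comp_self, Function.comp_id]
  rw [hV]

theorem proposition3 :
    (∃ K : ℕ, ∀ n : ℕ, 1 ≤ n →
      (gatherGate n).row (0, 0) = Matrix.vec (1 : Matrix (Fin (2 ^ n)) (Fin (2 ^ n)) ℂ) ∧
      ∃ C : QCircuit (Fin 2 ⊕ (Fin n ⊕ Fin n)),
        C.length ≤ K * n ^ 2 ∧
        ∀ ψ : Fin (2 ^ n) × Fin (2 ^ n) → ℂ,
          (QCircuit.toMatrix C).mulVec (ancillaTensor ![0, 0] (twoRegisters ψ)) =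
            ancillaTensor ![0, 0]
                (twoRegisters (((2 : ℂ) ^ n)⁻¹ • (gatherGate n).mulVec ψ)) +
              ancillaTensor ![1, 0]
                (twoRegisters (ψ - ((2 : ℂ) ^ n)⁻¹ • (gatherGate n).mulVec ψ))) ∧
    (∃ K : ℕ, ∀ n : ℕ, 1 ≤ n → ∀ v : Fin (2 ^ n) → ℂ, v ≠ 0 →
      (multGate n v).row 0 = v ∧
      ∃ C : QCircuit (Fin 1 ⊕ Fin n),
        C.length ≤ K * 2 ^ n ∧
        ∀ ψ : Fin (2 ^ n) → ℂ, ∃ χ : Fin (2 ^ n) → ℂ,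
          (QCircuit.toMatrix C).mulVec (ancillaTensor ![0] (oneRegister ψ)) =
            ancillaTensor ![0]
                (oneRegister (((∑ j, ‖v j‖ : ℝ) : ℂ)⁻¹ • (multGate n v).mulVec ψ)) +
              ancillaTensor ![1] (oneRegister χ)) := by
  -- `26 * n + 5 ≤ 31 * n ^ 2` for `n ≥ 1`.
  refine ⟨⟨31, fun n hn => ⟨gatherGate_row_zero n, ?_⟩⟩,
    ⟨8, fun n _ v _ => ⟨multGate_row_zero n v, exists_circuit_multGate n v⟩⟩⟩
  obtain ⟨C, hC, h⟩ := exists_circuit_gatherGate n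
  exact ⟨C, by rw [hC]; nlinarith, h⟩
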